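/- For a permutation $\pi\in S_n$ and $i\ge 1$ let $c_i(\pi)$ be the number of $i$-cycles of $\pi$ (fixed points are $1$-cycles, and $c_i(\pi)=0$ for $i>n$), and let $\sigma_k(q)=\sum_{d\mid q}d^k$. There are universal constants $C$ and $q_0$ such that for all integers $q\ge q_0$, all integers $\Delta\ge 1$ with $\Delta\le \frac{\log q}{\log 2}$, and all integers $n\ge 1$, \[ \frac{1}{n!}\sum_{j=1}^{\Delta}\sum_{\pi\in S_n}\binom{c_1(\pi^q)+\ldots+c_{j+1}(\pi^q)}{\Delta-j}\;\le\; C\cdot \begin{cases} 1 & \text{if } \Delta=1,\\ \sigma_0(q) & \text{if } \Delta=2,\\ \sigma_1(q) & \text{if } \Delta=3,\\ \frac{1}{(\Delta-1)!}\,q^{\Delta-2} & \text{if } \Delta\ge 4. \end{cases} \] -/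

import Mathlib

/-- The number `c_i(π)` of `i`-cycles of a permutation `π` of `{0, …, n-1}`, for `i ≥ 1`.
Fixed points count as `1`-cycles: `Equiv.Perm.partition` is the full cycle type of `π`,
including the parts equal to `1`. In particular `c_i(π) = 0` for `i > n`. -/
def cycleCount {n : ℕ} (i : ℕ) (π : Equiv.Perm (Fin n)) : ℕ :=
  π.partition.parts.count i

/-- `(1/n!) ∑_{j=1}^{Δ} ∑_{π ∈ S_n} binom(c_1(π^q) + … + c_{j+1}(π^q), Δ - j)`. -/
noncomputable def meanBinomSum (n q Δ : ℕ) : ℝ :=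
  (1 / (n.factorial : ℝ)) * ∑ j ∈ Finset.Icc 1 Δ, ∑ π : Equiv.Perm (Fin n),
    ((∑ i ∈ Finset.Icc 1 (j + 1), cycleCount i (π ^ q)).choose (Δ - j) : ℝ)

section

open Finset Nat

/-! Raising to the power `q` splits an `m`-cycle into `gcd(m,q)` cycles of length `m / gcd(m,q)`.
Hence the number X of cycles of `π^q` of length at most `k` is additive over the cycles of `π`, each
`m`-cycle contributing g(m) = `splitCount q k m` (`sum_count_parts_pow`).

Marking a cycle expresses (r+1) E_n binom(X, r+1) as the sum over a + b = r and m ≤ n of (a+1)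
binom(g(m), a+1) / m · E_{n-m} binom(X, b) (`succ_mul_meanChoose`). Since m ↦ (m / gcd(m,q),
gcd(m,q)) is injective, the total weight for a given a is at most H σ_a(q) / a!, uniformly in n,
where H bounds the k-th harmonic number (`sum_splitCount_le`). So r! E_n binom(X, r) ≤ β_r, with β_r
the r-th coefficient of the exponential generating function exp(∑ H σ_a(q) x^(a+1) / (a+1)!).

As σ_0 ≤ 2√q, σ_1 ≤ 2q^(3/2) and σ_a ≤ 2q^a for a ≥ 2, induction gives β_r = O(H^4 q^(r-1)) for r ≥
3 in the range needed, where 2^Δ ≤ q controls the sum of binomial coefficients. The term j = 1 (r =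
Δ-1) gives the claimed order, and for Δ ≥ 4 each later j adds at most a constant times a 1/Δ share
of it. The cases Δ ≤ 3 are read off from β_0, β_1, β_2. -/

/-! ### Cycle lengths as minimal periods of points. -/

theorem Equiv.Perm.minimalPeriod_eq_card_support_cycleOf {α : Type*} [DecidableEq α] [Fintype α]
    (σ : Equiv.Perm α) {x : α} (hx : σ x ≠ x) :
    Function.minimalPeriod σ x = (σ.cycleOf x).support.card := by
  have h := Equiv.Perm.isCycleOn_support_cycleOf σ x
  have hx' : x ∈ (σ.cycleOf x).support := by
    rw [Equiv.Perm.mem_support, Equiv.Perm.cycleOf_apply_self]; exact hx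
  apply Nat.dvd_antisymm
  · apply Function.IsPeriodicPt.minimalPeriod_dvd
    have := (h.pow_apply_eq hx' (n := (σ.cycleOf x).support.card)).2 dvd_rfl
    rwa [← Equiv.Perm.iterate_eq_pow] at this
  · rw [← h.pow_apply_eq hx', ← Equiv.Perm.iterate_eq_pow]
    exact Function.isPeriodicPt_minimalPeriod σ x

/-- The points lying on `i`-cycles are counted by `i` times the number of `i`-cycles. -/
theorem Equiv.Perm.card_filter_minimalPeriod {α : Type*} [DecidableEq α] [Fintype α]
    (σ : Equiv.Perm α) (i : ℕ) :
    #{x | Function.minimalPeriod σ x = i} = i * σ.partition.parts.count i := by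
  rcases lt_trichotomy i 1 with hi | rfl | hi
  · obtain rfl : i = 0 := by omega
    rw [zero_mul, Finset.card_eq_zero, filter_eq_empty_iff]
    intro x _ hx
    have hp : 0 < Function.minimalPeriod σ x :=
      Function.minimalPeriod_pos_of_mem_periodicPts
        (Function.Injective.mem_periodicPts σ.injective x)
    omega
  · rw [Equiv.Perm.parts_partition, Multiset.count_add, Multiset.count_replicate_self,
      Multiset.count_eq_zero_of_notMem, zero_add, one_mul]
    · rw [← Finset.card_compl]
      congr 1
      ext x
      simp [Function.minimalPeriod_eq_one_iff_isFixedPt, Function.IsFixedPt]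
    · intro h
      have := Equiv.Perm.two_le_of_mem_cycleType h
      omega
  · rw [Equiv.Perm.parts_partition, Multiset.count_add, Multiset.count_replicate,
      if_neg (by omega), add_zero, Equiv.Perm.CycleType.count_def]
    have key : ({x | Function.minimalPeriod σ x = i} : Finset α) =
        ({c ∈ σ.cycleFactorsFinset | c.support.card = i}).biUnion fun c => c.support := by
      ext x
      simp only [mem_filter, mem_univ, true_and, mem_biUnion]
      constructor
      · intro hx
        have hfx : σ x ≠ x := by
          intro h
          have : Function.minimalPeriod σ x = 1 :=
            Function.minimalPeriod_eq_one_iff_isFixedPt.2 h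
          omega
        refine ⟨σ.cycleOf x, ⟨?_, ?_⟩, ?_⟩
        · rw [Equiv.Perm.cycleOf_mem_cycleFactorsFinset_iff, Equiv.Perm.mem_support]; exact hfx
        · rw [← σ.minimalPeriod_eq_card_support_cycleOf hfx, hx]
        · rw [Equiv.Perm.mem_support, Equiv.Perm.cycleOf_apply_self]; exact hfx
      · rintro ⟨c, ⟨hc, hci⟩, hx⟩
        have hcx := Equiv.Perm.cycle_is_cycleOf hx hc
        have hfx : σ x ≠ x := by
          rw [← Equiv.Perm.mem_support]
          exact Equiv.Perm.mem_cycleFactorsFinset_support_le hc hx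
        rw [σ.minimalPeriod_eq_card_support_cycleOf hfx, ← hcx, hci]
    rw [key, Finset.card_biUnion]
    · rw [Finset.sum_congr rfl (g := fun _ => i) (fun c hc => (mem_filter.1 hc).2), sum_const,
        smul_eq_mul, mul_comm]
      congr 1
      rw [← Fintype.card_coe]
      refine Fintype.card_congr ⟨fun c => ⟨⟨c.1, (mem_filter.1 c.2).1⟩, (mem_filter.1 c.2).2⟩,
        fun c => ⟨c.1.1, mem_filter.2 ⟨c.1.2, c.2⟩⟩, ?_, ?_⟩
      · intro c; rfl
      · intro c; rfl
    · intro c hc d hd hcd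
      exact (Equiv.Perm.cycleFactorsFinset_pairwise_disjoint σ (mem_filter.1 hc).1
        (mem_filter.1 hd).1 hcd).disjoint_support

/-! ### Splitting of cycles under powers. -/

/-- The sum of `g` over the parts of a multiset. -/
def partStat (g : ℕ → ℕ) (s : Multiset ℕ) : ℕ := (s.map g).sum

/-- The number of cycles of length at most `k` into which an `m`-cycle splits when raised to
the power `q`. -/
def splitCount (q k m : ℕ) : ℕ := if m / m.gcd q ≤ k then m.gcd q else 0

/-- The orbit of a point of minimal period `m` contributes `1/m` per point. -/
theorem Equiv.Perm.sum_minimalPeriod {α : Type*} [DecidableEq α] [Fintype α]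
    (σ : Equiv.Perm α) (f : ℕ → ℚ) :
    ∑ x, f (Function.minimalPeriod σ x) / (Function.minimalPeriod σ x : ℚ) =
      (σ.partition.parts.map f).sum := by
  rw [Finset.sum_multiset_map_count]
  have hmem : ∀ x ∈ (univ : Finset α),
      Function.minimalPeriod σ x ∈ σ.partition.parts.toFinset := by
    intro x _
    have h := σ.card_filter_minimalPeriod (Function.minimalPeriod σ x)
    have hx : x ∈ ({y | Function.minimalPeriod σ y = Function.minimalPeriod σ x} : Finset α) := by
      simp
    have h2 := Finset.card_pos.2 ⟨x, hx⟩
    rw [h] at h2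
    rw [Multiset.mem_toFinset]
    exact Multiset.count_pos.1 (Nat.pos_of_mul_pos_left h2)
  rw [← Finset.sum_fiberwise_of_maps_to hmem]
  refine Finset.sum_congr rfl fun m hm => ?_
  have hm0 : (m : ℚ) ≠ 0 := by
    have := σ.partition.parts_pos (Multiset.mem_toFinset.1 hm)
    positivity
  rw [Finset.sum_congr rfl (g := fun _ => f m / m)
    (fun x hx => by rw [(mem_filter.1 hx).2]), sum_const, σ.card_filter_minimalPeriod]
  simp only [nsmul_eq_mul]
  push_cast
  field_simp

/-- The short cycles of `σ ^ q`, counted through the cycles of `σ`. -/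
theorem sum_count_parts_pow {α : Type*} [DecidableEq α] [Fintype α]
    (σ : Equiv.Perm α) {q : ℕ} (hq : q ≠ 0) (k : ℕ) :
    ∑ i ∈ Icc 1 k, (σ ^ q).partition.parts.count i =
      partStat (splitCount q k) σ.partition.parts := by
  have h1 := (σ ^ q).sum_minimalPeriod (fun m => if m ≤ k then 1 else 0)
  have h2 := σ.sum_minimalPeriod (fun m => (splitCount q k m : ℚ))
  have h3 : ((σ ^ q).partition.parts.map (fun m => if m ≤ k then (1 : ℚ) else 0)).sum =
      ((∑ i ∈ Icc 1 k, (σ ^ q).partition.parts.count i : ℕ) : ℚ) := by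
    rw [Finset.sum_multiset_map_count]
    simp only [nsmul_eq_mul, mul_ite, mul_one, mul_zero]
    rw [← Finset.sum_filter]
    push_cast
    refine Finset.sum_subset_zero_on_sdiff ?_ ?_ (fun _ _ => rfl)
    · intro m hm
      have h := mem_filter.1 hm
      have := (σ ^ q).partition.parts_pos (Multiset.mem_toFinset.1 h.1)
      exact mem_Icc.2 ⟨this, h.2⟩
    · intro m hm
      have h := mem_sdiff.1 hm
      have h4 : m ∉ (σ ^ q).partition.parts := by
        intro h5
        exact h.2 (mem_filter.2 ⟨Multiset.mem_toFinset.2 h5, (mem_Icc.1 h.1).2⟩)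
      simp [Multiset.count_eq_zero_of_notMem h4]
  have h4 : (σ.partition.parts.map (fun m => (splitCount q k m : ℚ))).sum =
      (partStat (splitCount q k) σ.partition.parts : ℚ) := by
    rw [partStat, Nat.cast_multiset_sum, Multiset.map_map]; rfl
  rw [h3] at h1
  rw [h4] at h2
  have h5 : ((∑ i ∈ Icc 1 k, (σ ^ q).partition.parts.count i : ℕ) : ℚ) =
      (partStat (splitCount q k) σ.partition.parts : ℚ) := by
    rw [← h1, ← h2]
    -- The two sums agree point by point: with g = gcd(m,q), a point of period m under `σ` has
    -- period m/g under `σ ^ q`, and 1/(m/g) = g/m.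
    refine Finset.sum_congr rfl fun x _ => ?_
    have hp : 0 < Function.minimalPeriod σ x :=
      Function.minimalPeriod_pos_of_mem_periodicPts
        (Function.Injective.mem_periodicPts σ.injective x)
    have hpow : Function.minimalPeriod (σ ^ q : Equiv.Perm α) x =
        Function.minimalPeriod σ x / (Function.minimalPeriod σ x).gcd q := by
      rw [← Equiv.Perm.iterate_eq_pow, Function.minimalPeriod_iterate_eq_div_gcd hq]
    rw [hpow]
    set m := Function.minimalPeriod σ x
    have hg : 0 < m.gcd q := Nat.gcd_pos_of_pos_left _ hp
    have hgm := Nat.gcd_dvd_left m q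
    rw [Nat.cast_div hgm (by positivity), splitCount]
    split_ifs
    · field_simp
    · simp
  exact_mod_cast h5

/-! ### Means over the symmetric group as sums over partitions. -/

/-- The size of the centralizer of a permutation with the given multiset of cycle lengths. -/
def centralizerSize (s : Multiset ℕ) : ℕ := s.prod * ∏ m ∈ s.toFinset, (s.count m)!

theorem centralizerSize_pos {s : Multiset ℕ} (hs : ∀ m ∈ s, 0 < m) : 0 < centralizerSize s :=
  Nat.mul_pos (Multiset.prod_pos hs) (Finset.prod_pos fun _ _ => Nat.factorial_pos _)

theorem prod_count_factorial_of_subset (s : Multiset ℕ) {T : Finset ℕ} (h : s.toFinset ⊆ T) :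
    ∏ m ∈ s.toFinset, (s.count m)! = ∏ m ∈ T, (s.count m)! :=
  Finset.prod_subset h fun m _ hm => by
    rw [Multiset.mem_toFinset] at hm
    rw [Multiset.count_eq_zero_of_notMem hm, Nat.factorial_zero]

/-- When a part is marked with its multiplicity, the factor `s.count m + 1` cancels and only the
weight 1/m survives. -/
theorem centralizerSize_cons (m : ℕ) (s : Multiset ℕ) :
    centralizerSize (m ::ₘ s) = m * (s.count m + 1) * centralizerSize s := by
  unfold centralizerSize
  rw [Multiset.prod_cons, Multiset.toFinset_cons,
    prod_count_factorial_of_subset s (Finset.subset_insert m s.toFinset),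
    ← Finset.mul_prod_erase _ _ (Finset.mem_insert_self m s.toFinset),
    ← Finset.mul_prod_erase (insert m s.toFinset) (fun i => (s.count i)!)
      (Finset.mem_insert_self m s.toFinset),
    Multiset.count_cons_self, Nat.factorial_succ]
  rw [Finset.prod_congr rfl (g := fun i => (s.count i)!) (fun i hi => by
    rw [Multiset.count_cons_of_ne (Finset.ne_of_mem_erase hi)])]
  ring

/-- `Equiv.Perm.card_of_cycleType_mul_eq` counts by the cycle lengths that are at least 2; the fixed
points supply the missing factor (count of 1)!. -/
theorem card_filter_parts_mul {α : Type*} [DecidableEq α] [Fintype α]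
    (p : (Fintype.card α).Partition) :
    #{σ : Equiv.Perm α | σ.partition = p} * centralizerSize p.parts = (Fintype.card α)! := by
  set t := p.parts.filter (2 ≤ ·) with ht
  have hone : p.parts.filter (fun m => ¬ 2 ≤ m) = Multiset.replicate (p.parts.count 1) 1 := by
    rw [← Multiset.filter_eq']
    refine Multiset.filter_congr fun m hm => ?_
    have := p.parts_pos hm
    omega
  have hsplit : p.parts = t + Multiset.replicate (p.parts.count 1) 1 := by
    rw [← hone, ht, Multiset.filter_add_not]
  have hsum : Fintype.card α = t.sum + p.parts.count 1 := by
    have := congrArg Multiset.sum hsplit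
    simpa [p.parts_sum] using this
  have hcount : Fintype.card α - t.sum = p.parts.count 1 := by omega
  have hset : ({σ | σ.partition = p} : Finset (Equiv.Perm α)) =
      ({σ | σ.cycleType = t} : Finset (Equiv.Perm α)) := by
    ext σ
    simp only [mem_filter, mem_univ, true_and]
    constructor
    · rintro rfl
      rw [ht, Equiv.Perm.filter_parts_partition_eq_cycleType]
    · intro h
      ext1
      rw [Equiv.Perm.parts_partition, h, ← Equiv.Perm.sum_cycleType, h]
      conv_rhs => rw [hsplit]
      rw [hcount]
  have h2 : ∀ a ∈ t, 2 ≤ a := fun a ha => (Multiset.mem_filter.1 ha).2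
  have hcard := Equiv.Perm.card_of_cycleType_mul_eq α t
  rw [if_pos ⟨by omega, h2⟩] at hcard
  rw [hset, ← hcard]
  congr 1
  have h1t : 1 ∉ t := fun h => by simpa using h2 1 h
  have hprod : p.parts.prod = t.prod := by
    conv_lhs => rw [hsplit]
    simp
  have hsub : p.parts.toFinset ⊆ insert 1 t.toFinset := by
    intro m hm
    rw [Multiset.mem_toFinset] at hm
    have := p.parts_pos hm
    rw [mem_insert, Multiset.mem_toFinset, ht, Multiset.mem_filter]
    by_cases h : m = 1
    · exact Or.inl h
    · exact Or.inr ⟨hm, by omega⟩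
  rw [centralizerSize, hprod, prod_count_factorial_of_subset _ hsub,
    Finset.prod_insert (by rwa [Multiset.mem_toFinset]), hcount,
    Finset.prod_congr rfl (g := fun i => (t.count i)!) (fun i hi => by
      rw [ht, Multiset.count_filter_of_pos (h2 i (Multiset.mem_toFinset.1 hi))])]
  ring

/-- The mean over `S_n` of a function of the cycle type, as a sum over partitions. -/
theorem mean_eq_sum_partition (n : ℕ) (F : Multiset ℕ → ℝ) :
    (∑ σ : Equiv.Perm (Fin n), F σ.partition.parts) / n ! =
      ∑ p : n.Partition, F p.parts / centralizerSize p.parts := by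
  -- `σ.partition` is a partition of `Fintype.card (Fin n)`, not syntactically of `n`; generalizing
  -- makes the two types coincide.
  suffices h : ∀ N, Fintype.card (Fin n) = N →
      (∑ σ : Equiv.Perm (Fin n), F σ.partition.parts) / N ! =
        ∑ p : N.Partition, F p.parts / centralizerSize p.parts from h n (Fintype.card_fin n)
  rintro N rfl
  rw [← Finset.sum_fiberwise univ (fun σ : Equiv.Perm (Fin n) => σ.partition), Finset.sum_div]
  refine Finset.sum_congr rfl fun p _ => ?_
  rw [Finset.sum_congr rfl (g := fun _ => F p.parts)
    (fun x hx => by rw [(mem_filter.1 hx).2]), sum_const, nsmul_eq_mul]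
  have h := card_filter_parts_mul p
  have hz : (centralizerSize p.parts : ℝ) ≠ 0 := by
    exact_mod_cast (centralizerSize_pos fun m hm => p.parts_pos hm).ne'
  have hN : ((Fintype.card (Fin n))! : ℝ) ≠ 0 := by positivity
  rw [div_eq_div_iff hN hz, ← h]
  push_cast
  ring

/-! ### The recursion obtained by marking a cycle. -/

/-- Marking a part of a partition. -/
theorem sum_partition_mark (n : ℕ) (ψ : ℕ → Multiset ℕ → ℝ) :
    ∑ p : n.Partition, (∑ m ∈ p.parts.toFinset, p.parts.count m * ψ m (p.parts.erase m)) /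
        centralizerSize p.parts =
      ∑ m ∈ Icc 1 n, (∑ p : (n - m).Partition, ψ m p.parts / centralizerSize p.parts) / m := by
  have h1 : ∀ p : n.Partition,
      (∑ m ∈ p.parts.toFinset, p.parts.count m * ψ m (p.parts.erase m)) /
        (centralizerSize p.parts : ℝ) = ∑ m ∈ Icc 1 n, if m ∈ p.parts then
          p.parts.count m * ψ m (p.parts.erase m) / (centralizerSize p.parts : ℝ) else 0 := by
    intro p
    rw [Finset.sum_div, ← Finset.sum_filter]
    refine Finset.sum_congr ?_ fun _ _ => rfl
    ext m
    rw [Multiset.mem_toFinset, mem_filter, mem_Icc]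
    exact ⟨fun h => ⟨⟨p.parts_pos h, p.le_of_mem_parts h⟩, h⟩, fun h => h.2⟩
  rw [Finset.sum_congr rfl fun p _ => h1 p, Finset.sum_comm]
  refine Finset.sum_congr rfl fun m hm => ?_
  obtain ⟨hm1, hmn⟩ := mem_Icc.1 hm
  rw [← Finset.sum_filter, Finset.sum_div]
  refine Finset.sum_bij'
    (fun p hp => ⟨p.parts.erase m, fun h => p.parts_pos (Multiset.mem_of_mem_erase h), by
      have := Multiset.sum_erase (mem_filter.1 hp).2
      rw [p.parts_sum] at this
      omega⟩)
    (fun p _ => ⟨m ::ₘ p.parts, fun h => by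
      rcases Multiset.mem_cons.1 h with rfl | h
      · exact hm1
      · exact p.parts_pos h, by rw [Multiset.sum_cons, p.parts_sum]; omega⟩)
    (fun _ _ => mem_univ _) (fun p _ => by simp) ?_ ?_ ?_
  · intro p hp
    ext1
    exact Multiset.cons_erase (mem_filter.1 hp).2
  · intro p _
    ext1
    exact Multiset.erase_cons_head m p.parts
  · intro p hp
    have hmem := (mem_filter.1 hp).2
    obtain ⟨s, hs⟩ := Multiset.exists_cons_of_mem hmem
    have hz : (centralizerSize s : ℝ) ≠ 0 := by
      have : 0 < centralizerSize s := centralizerSize_pos fun i hi =>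
        p.parts_pos (by rw [hs]; exact Multiset.mem_cons_of_mem hi)
      positivity
    have hm0 : (m : ℝ) ≠ 0 := by positivity
    simp only [hs, Multiset.erase_cons_head, centralizerSize_cons, Multiset.count_cons_self]
    push_cast
    field_simp

/-- Write (r+1) binom(X, r+1) = X binom(X-1, r), expand the factor X over the parts, and apply
Vandermonde to X-1 = (g(m)-1) + (the rest), using g binom(g-1, a) = (a+1) binom(g, a+1). -/
theorem succ_mul_choose_partStat (g : ℕ → ℕ) (s : Multiset ℕ) (r : ℕ) :
    (r + 1) * (partStat g s).choose (r + 1) =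
      ∑ m ∈ s.toFinset, s.count m * ∑ ab ∈ antidiagonal r,
        (ab.1 + 1) * (g m).choose (ab.1 + 1) * (partStat g (s.erase m)).choose ab.2 := by
  have h1 : (r + 1) * (partStat g s).choose (r + 1) =
      partStat g s * (partStat g s - 1).choose r := by
    rcases Nat.eq_zero_or_pos (partStat g s) with h | h
    · simp [h]
    · have := Nat.add_one_mul_choose_eq (partStat g s - 1) r
      rw [Nat.sub_add_cancel h] at this
      rw [this]; ring
  have h2 : partStat g s = ∑ m ∈ s.toFinset, s.count m * g m :=
    Finset.sum_multiset_map_count s g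
  rw [h1]
  nth_rewrite 1 [h2]
  rw [Finset.sum_mul]
  refine Finset.sum_congr rfl fun m hm => ?_
  rw [mul_assoc]
  congr 1
  have hX : partStat g s = g m + partStat g (s.erase m) := by
    conv_lhs => rw [← Multiset.cons_erase (Multiset.mem_toFinset.1 hm)]
    simp [partStat]
  rcases hG : g m with _ | G
  · simp
  · rw [hG] at hX
    rw [hX,
      show G + 1 + partStat g (s.erase m) - 1 = G + partStat g (s.erase m) by omega,
      Nat.add_choose_eq, Finset.mul_sum]
    refine Finset.sum_congr rfl fun ab _ => ?_
    have := Nat.add_one_mul_choose_eq G ab.1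
    rw [← mul_assoc, this]
    ring

/-- The mean of `binom(X, r)` over `S_n`, where `X` is the sum of `g` over the cycle lengths. -/
noncomputable def meanChoose (g : ℕ → ℕ) (n r : ℕ) : ℝ :=
  (∑ σ : Equiv.Perm (Fin n), ((partStat g σ.partition.parts).choose r : ℝ)) / n !

theorem meanChoose_zero (g : ℕ → ℕ) (n : ℕ) : meanChoose g n 0 = 1 := by
  have : (n ! : ℝ) ≠ 0 := by positivity
  simp [meanChoose, Fintype.card_perm, this]

/-- The recursion for `meanChoose` obtained by marking a cycle. -/
theorem succ_mul_meanChoose (g : ℕ → ℕ) (n r : ℕ) :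
    (r + 1) * meanChoose g n (r + 1) = ∑ ab ∈ antidiagonal r, ∑ m ∈ Icc 1 n,
      ((ab.1 + 1) * (g m).choose (ab.1 + 1) : ℝ) / m * meanChoose g (n - m) ab.2 := by
  have h1 : ∀ n r, meanChoose g n r =
      ∑ p : n.Partition, ((partStat g p.parts).choose r : ℝ) / centralizerSize p.parts :=
    fun n r => mean_eq_sum_partition n fun s => ((partStat g s).choose r : ℝ)
  have h2 := sum_partition_mark n fun m s => ∑ ab ∈ antidiagonal r,
    ((ab.1 + 1) * (g m).choose (ab.1 + 1) * (partStat g s).choose ab.2 : ℝ)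
  rw [h1, Finset.mul_sum]
  have h3 : ∀ p : n.Partition, ((r : ℝ) + 1) *
      (((partStat g p.parts).choose (r + 1) : ℝ) / centralizerSize p.parts) =
      (∑ m ∈ p.parts.toFinset, p.parts.count m * ∑ ab ∈ antidiagonal r,
        ((ab.1 + 1) * (g m).choose (ab.1 + 1) *
          (partStat g (p.parts.erase m)).choose ab.2 : ℝ)) / centralizerSize p.parts := by
    intro p
    rw [← mul_div_assoc]
    congr 1
    exact_mod_cast succ_mul_choose_partStat g p.parts r
  rw [Finset.sum_congr rfl fun p _ => h3 p, h2, Finset.sum_comm]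
  refine Finset.sum_congr rfl fun m _ => ?_
  simp only [h1, Finset.sum_div]
  rw [Finset.sum_comm]
  refine Finset.sum_congr rfl fun ab _ => ?_
  rw [Finset.mul_sum]
  refine Finset.sum_congr rfl fun p _ => ?_
  ring

/-! ### Marking weights and the exponential majorant. -/

theorem succ_mul_choose_div_le (G a : ℕ) {i : ℝ} (hi : 0 < i) :
    ((a + 1) * G.choose (a + 1) : ℝ) / (i * G) ≤ (G : ℝ) ^ a / (a ! * i) := by
  rcases Nat.eq_zero_or_pos G with rfl | hG
  · simp; positivity
  have hG' : (0 : ℝ) < G := by exact_mod_cast hG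
  have h := Nat.choose_le_pow_div (α := ℝ) (a + 1) G
  rw [Nat.factorial_succ] at h
  push_cast at h
  rw [le_div_iff₀ (by positivity)] at h
  rw [div_le_div_iff₀ (by positivity) (by positivity)]
  calc ((a + 1) * G.choose (a + 1) : ℝ) * (a ! * i)
      = (G.choose (a + 1) * ((a + 1) * a !)) * i := by ring
    _ ≤ G ^ (a + 1) * i := by gcongr
    _ = G ^ a * (i * G) := by ring

/-- Write m = i·d with d = gcd(m,q). The pairs (i,d) are distinct and lie in [1,k] × divisors of q,
and the summand is at most d^a / (a! i), so the sum factors into a harmonic sum and a divisor sum.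
-/
theorem sum_splitCount_le {q k : ℕ} (hq : q ≠ 0) {H : ℝ}
    (hH : ∑ i ∈ Icc 1 k, (1 / i : ℝ) ≤ H) (n a : ℕ) :
    ∑ m ∈ Icc 1 n, ((a + 1) * (splitCount q k m).choose (a + 1) : ℝ) / m ≤
      H * ArithmeticFunction.sigma a q / a ! := by
  have h1 : ∑ m ∈ Icc 1 n, ((a + 1) * (splitCount q k m).choose (a + 1) : ℝ) / m =
      ∑ m ∈ Icc 1 n with m / m.gcd q ≤ k, ((a + 1) * (m.gcd q).choose (a + 1) : ℝ) / m := by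
    rw [Finset.sum_filter]
    refine Finset.sum_congr rfl fun m _ => ?_
    unfold splitCount
    split_ifs <;> simp
  set w : ℕ × ℕ → ℝ := fun x => (x.2 : ℝ) ^ a / (a ! * x.1) with hw
  have h2 : ∀ m ∈ ({m ∈ Icc 1 n | m / m.gcd q ≤ k} : Finset ℕ),
      ((a + 1) * (m.gcd q).choose (a + 1) : ℝ) / m ≤ w (m / m.gcd q, m.gcd q) := by
    intro m hm
    have hm1 := (mem_Icc.1 (mem_filter.1 hm).1).1
    have hdvd := Nat.gcd_dvd_left m q
    have hg : 0 < m.gcd q := Nat.gcd_pos_of_pos_left _ hm1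
    have hi : 0 < m / m.gcd q := Nat.div_pos (Nat.le_of_dvd hm1 hdvd) hg
    have hm' : (m : ℝ) = ((m / m.gcd q : ℕ) : ℝ) * (m.gcd q : ℕ) := by
      exact_mod_cast (Nat.div_mul_cancel hdvd).symm
    have := succ_mul_choose_div_le (m.gcd q) a (i := ((m / m.gcd q : ℕ) : ℝ))
      (by exact_mod_cast hi)
    rwa [← hm'] at this
  have hinj : Set.InjOn (fun m => (m / m.gcd q, m.gcd q))
      (({m ∈ Icc 1 n | m / m.gcd q ≤ k} : Finset ℕ) : Set ℕ) := by
    intro x _ y _ hxy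
    have h := Prod.ext_iff.1 hxy
    simp only at h
    rw [← Nat.div_mul_cancel (Nat.gcd_dvd_left x q), h.1, h.2,
      Nat.div_mul_cancel (Nat.gcd_dvd_left y q)]
  have hσ : (0 : ℝ) ≤ ArithmeticFunction.sigma a q / a ! := by positivity
  calc _ = _ := h1
    _ ≤ _ := Finset.sum_le_sum h2
    _ = ∑ x ∈ ({m ∈ Icc 1 n | m / m.gcd q ≤ k} : Finset ℕ).image
          (fun m => (m / m.gcd q, m.gcd q)), w x := (Finset.sum_image hinj).symm
    _ ≤ ∑ x ∈ Icc 1 k ×ˢ q.divisors, w x := by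
        refine Finset.sum_le_sum_of_subset_of_nonneg ?_ fun x _ _ => by positivity
        intro x hx
        obtain ⟨m, hm, rfl⟩ := mem_image.1 hx
        have hm1 := (mem_Icc.1 (mem_filter.1 hm).1).1
        refine mem_product.2 ⟨mem_Icc.2 ⟨?_, (mem_filter.1 hm).2⟩,
          Nat.mem_divisors.2 ⟨Nat.gcd_dvd_right m q, hq⟩⟩
        exact Nat.div_pos (Nat.le_of_dvd hm1 (Nat.gcd_dvd_left m q))
          (Nat.gcd_pos_of_pos_left _ hm1)
    _ = (∑ i ∈ Icc 1 k, (1 / i : ℝ)) * (ArithmeticFunction.sigma a q / a !) := by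
        rw [Finset.sum_product, Finset.sum_mul]
        refine Finset.sum_congr rfl fun i _ => ?_
        rw [ArithmeticFunction.sigma_apply, Nat.cast_sum, Finset.sum_div, Finset.mul_sum]
        refine Finset.sum_congr rfl fun d _ => ?_
        simp only [hw]
        push_cast
        simp only [div_eq_mul_inv, mul_inv, one_mul]
        ring
    _ ≤ H * (ArithmeticFunction.sigma a q / a !) := by gcongr
    _ = _ := by ring

/-- The sequence with exponential generating function `exp (∑ A_a x ^ (a + 1) / (a + 1)!)`. -/
noncomputable def expMajorant (A : ℕ → ℝ) : ℕ → ℝ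
  | 0 => 1
  | r + 1 => ∑ a : Fin (r + 1), r.choose a * A a * expMajorant A (r - a)
termination_by r => r
decreasing_by omega

theorem expMajorant_zero (A : ℕ → ℝ) : expMajorant A 0 = 1 := by rw [expMajorant]

theorem expMajorant_succ (A : ℕ → ℝ) (r : ℕ) :
    expMajorant A (r + 1) = ∑ a ∈ range (r + 1), r.choose a * A a * expMajorant A (r - a) := by
  rw [expMajorant, Finset.sum_range fun a => (r.choose a : ℝ) * A a * expMajorant A (r - a)]

theorem expMajorant_nonneg {A : ℕ → ℝ} (hA : ∀ a, 0 ≤ A a) (r : ℕ) : 0 ≤ expMajorant A r := by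
  induction r using Nat.strong_induction_on with
  | _ r ih =>
    rcases r with _ | r
    · rw [expMajorant_zero]; exact zero_le_one
    · rw [expMajorant_succ]
      refine Finset.sum_nonneg fun a _ => ?_
      have := ih (r - a) (by omega)
      have := hA a
      positivity

/-- The marking recursion becomes that of `expMajorant` after multiplying by r!. Uniformity in `n`
is essential, since the recursion passes from n to n - m. -/
theorem meanChoose_le_expMajorant {g : ℕ → ℕ} {A : ℕ → ℝ} (hA0 : ∀ a, 0 ≤ A a)
    (hA : ∀ n a : ℕ, ∑ m ∈ Icc 1 n, ((a + 1) * (g m).choose (a + 1) : ℝ) / m ≤ A a / a !)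
    (r n : ℕ) : meanChoose g n r ≤ expMajorant A r / r ! := by
  induction r using Nat.strong_induction_on generalizing n with
  | _ r ih =>
    rcases r with _ | r
    · simp [meanChoose_zero, expMajorant_zero]
    · have h := succ_mul_meanChoose g n r
      have h2 : ((r : ℝ) + 1) * meanChoose g n (r + 1) ≤ expMajorant A (r + 1) / r ! := by
        rw [h, expMajorant_succ, Finset.Nat.sum_antidiagonal_eq_sum_range_succ_mk, Finset.sum_div]
        refine Finset.sum_le_sum fun a ha => ?_
        have har : a ≤ r := Nat.lt_succ_iff.1 (mem_range.1 ha)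
        have hβ := expMajorant_nonneg hA0 (r - a)
        calc _ ≤ ∑ m ∈ Icc 1 n, ((a + 1) * (g m).choose (a + 1) : ℝ) / m *
                (expMajorant A (r - a) / (r - a)!) :=
              Finset.sum_le_sum fun m _ => by
                have := ih (r - a) (by omega) (n - m)
                gcongr
          _ ≤ A a / a ! * (expMajorant A (r - a) / (r - a)!) := by
              rw [← Finset.sum_mul]
              have := hA n a
              gcongr
          _ = _ := by
              rw [Nat.cast_choose ℝ har]
              have h1 : (r ! : ℝ) ≠ 0 := by positivity
              field_simp
      rw [Nat.factorial_succ]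
      push_cast
      rw [← div_div, div_right_comm, le_div_iff₀ (by positivity), mul_comm]
      exact h2

/-! ### Elementary bounds for divisor sums. -/

theorem sigma_zero_le_two_mul_sqrt (q : ℕ) :
    (ArithmeticFunction.sigma 0 q : ℝ) ≤ 2 * √q := by
  rw [ArithmeticFunction.sigma_zero_apply]
  have h1 : q.divisors ⊆ Icc 1 q.sqrt ∪ (Icc 1 q.sqrt).image (q / ·) := by
    intro d hd
    have hdq := Nat.dvd_of_mem_divisors hd
    have hd0 := Nat.pos_of_mem_divisors hd
    have hq0 : 0 < q := Nat.pos_of_ne_zero (Nat.mem_divisors.1 hd).2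
    rw [mem_union, mem_image]
    by_cases h : d ≤ q.sqrt
    · exact Or.inl (mem_Icc.2 ⟨hd0, h⟩)
    · refine Or.inr ⟨q / d, mem_Icc.2 ⟨Nat.div_pos (Nat.le_of_dvd hq0 hdq) hd0, ?_⟩,
        Nat.div_div_self hdq hq0.ne'⟩
      by_contra h2
      have h3 := Nat.mul_div_cancel' hdq
      have h4 := Nat.lt_succ_sqrt q
      push Not at h h2
      have := Nat.mul_le_mul h h2
      simp only [Nat.succ_eq_add_one] at *
      omega
  have h2 : #q.divisors ≤ 2 * q.sqrt := by
    refine (card_le_card h1).trans ((card_union_le _ _).trans ?_)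
    have := Finset.card_image_le (s := Icc 1 q.sqrt) (f := (q / ·))
    rw [Nat.card_Icc] at *
    omega
  have h3 : (q.sqrt : ℝ) ≤ √q := Real.nat_sqrt_le_real_sqrt
  calc ((#q.divisors : ℕ) : ℝ) ≤ ((2 * q.sqrt : ℕ) : ℝ) := by exact_mod_cast h2
    _ = 2 * q.sqrt := by push_cast; ring
    _ ≤ _ := by gcongr

theorem sigma_one_le (q : ℕ) : (ArithmeticFunction.sigma 1 q : ℝ) ≤ 2 * q * √q := by
  have h : ArithmeticFunction.sigma 1 q ≤ q * ArithmeticFunction.sigma 0 q := by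
    rw [ArithmeticFunction.sigma_one_apply, ArithmeticFunction.sigma_zero_apply]
    have := Finset.sum_le_card_nsmul q.divisors (fun d => d) q
      fun d hd => Nat.divisor_le hd
    rw [smul_eq_mul] at this
    linarith
  have h0 := sigma_zero_le_two_mul_sqrt q
  calc (ArithmeticFunction.sigma 1 q : ℝ) ≤ q * ArithmeticFunction.sigma 0 q := by exact_mod_cast h
    _ ≤ q * (2 * √q) := by gcongr
    _ = _ := by ring

/-- σ_a(q) = ∑ (q/d)^a ≤ q^a ∑ 1/d², and the last sum is at most 2. -/
theorem sigma_le_two_mul_pow (q : ℕ) {a : ℕ} (ha : 2 ≤ a) :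
    (ArithmeticFunction.sigma a q : ℝ) ≤ 2 * (q : ℝ) ^ a := by
  rw [ArithmeticFunction.sigma_eq_sum_div]
  push_cast
  have h1 : ∀ d ∈ q.divisors, (((q / d : ℕ) : ℝ)) ^ a ≤ q ^ a * ((d : ℝ) ^ 2)⁻¹ := by
    intro d hd
    have hd0 := Nat.pos_of_mem_divisors hd
    have hd1 : (1 : ℝ) ≤ d := by exact_mod_cast hd0
    have h2 : (d : ℝ) ^ 2 ≤ d ^ a := pow_le_pow_right₀ hd1 ha
    rw [Nat.cast_div (Nat.dvd_of_mem_divisors hd) (by positivity), div_pow, div_eq_mul_inv]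
    gcongr
  refine (Finset.sum_le_sum h1).trans ?_
  rw [← Finset.mul_sum, mul_comm]
  gcongr
  have h3 := sum_Ioo_inv_sq_le (α := ℝ) 0 (q + 1)
  norm_num at h3
  refine le_trans (Finset.sum_le_sum_of_subset_of_nonneg ?_ fun _ _ _ => by positivity) h3
  intro d hd
  have hd0 := Nat.pos_of_mem_divisors hd
  have := Nat.divisor_le hd
  exact mem_Ioo.2 ⟨hd0, by omega⟩

/-! ### Growth of the majorant, with `t` in the role of √q. -/

section MajorantBounds

variable {σ : ℕ → ℝ} {H t : ℝ}

theorem expMajorant_one_le (hH : 1 ≤ H) (h0 : σ 0 ≤ 2 * t) :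
    expMajorant (fun a => H * σ a) 1 ≤ 2 * H * t := by
  rw [expMajorant_succ]
  simp only [zero_add, sum_range_one, Nat.choose_self, Nat.cast_one, one_mul, Nat.sub_self,
    expMajorant_zero, mul_one]
  nlinarith

theorem expMajorant_two_eq :
    expMajorant (fun a => H * σ a) 2 = H ^ 2 * σ 0 ^ 2 + H * σ 1 := by
  simp [expMajorant_succ, Finset.sum_range_succ, expMajorant_zero]
  ring

theorem expMajorant_two_le (hH : 1 ≤ H) (ht : 1 ≤ t) (hσ : ∀ a, 0 ≤ σ a) (h0 : σ 0 ≤ 2 * t)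
    (h1 : σ 1 ≤ 2 * t ^ 3) : expMajorant (fun a => H * σ a) 2 ≤ 6 * H ^ 2 * t ^ 3 := by
  rw [expMajorant_two_eq]
  have h2 := hσ 0
  calc H ^ 2 * σ 0 ^ 2 + H * σ 1 ≤ H ^ 2 * (2 * t) ^ 2 + H * (2 * t ^ 3) := by gcongr
    _ = 4 * H ^ 2 * (t ^ 2) + 2 * H * t ^ 3 := by ring
    _ ≤ 4 * H ^ 2 * t ^ 3 + 2 * H ^ 2 * t ^ 3 := by
        gcongr
        · norm_num
        · exact le_self_pow₀ hH (by norm_num)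
    _ = _ := by ring

theorem expMajorant_three_le (hH : 1 ≤ H) (ht : 1 ≤ t) (hσ : ∀ a, 0 ≤ σ a) (h0 : σ 0 ≤ 2 * t)
    (h1 : σ 1 ≤ 2 * t ^ 3) (h2 : ∀ a, 2 ≤ a → σ a ≤ 2 * t ^ (2 * a)) :
    expMajorant (fun a => H * σ a) 3 ≤ 22 * H ^ 3 * t ^ 4 := by
  have hA : ∀ a, 0 ≤ H * σ a := fun a => mul_nonneg (by linarith) (hσ a)
  have b1 := expMajorant_one_le hH h0
  have b2 := expMajorant_two_le hH ht hσ h0 h1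
  have p1 := expMajorant_nonneg hA 1
  have p2 := expMajorant_nonneg hA 2
  have s0 := hσ 0
  have s1 := hσ 1
  have s2 := h2 2 le_rfl
  have hH2 : H ≤ H ^ 3 := le_self_pow₀ hH (by norm_num)
  have hH3 : H ^ 2 ≤ H ^ 3 := pow_le_pow_right₀ hH (by norm_num)
  rw [expMajorant_succ]
  simp only [Finset.sum_range_succ, Finset.sum_range_zero]
  norm_num [Nat.choose, expMajorant_zero]
  calc H * σ 0 * expMajorant (fun a => H * σ a) 2 + 2 * (H * σ 1) *
        expMajorant (fun a => H * σ a) 1 + H * σ 2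
      ≤ H * (2 * t) * (6 * H ^ 2 * t ^ 3) + 2 * (H * (2 * t ^ 3)) * (2 * H * t) +
        H * (2 * t ^ (2 * 2)) := by gcongr
    _ = 12 * H ^ 3 * t ^ 4 + 8 * H ^ 2 * t ^ 4 + 2 * H * t ^ 4 := by ring
    _ ≤ 12 * H ^ 3 * t ^ 4 + 8 * H ^ 3 * t ^ 4 + 2 * H ^ 3 * t ^ 4 := by gcongr
    _ = _ := by ring

theorem expMajorant_four_le (hH : 1 ≤ H) (ht : 1 ≤ t) (hσ : ∀ a, 0 ≤ σ a) (h0 : σ 0 ≤ 2 * t)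
    (h1 : σ 1 ≤ 2 * t ^ 3) (h2 : ∀ a, 2 ≤ a → σ a ≤ 2 * t ^ (2 * a)) :
    expMajorant (fun a => H * σ a) 4 ≤ 94 * H ^ 4 * t ^ 6 := by
  have hA : ∀ a, 0 ≤ H * σ a := fun a => mul_nonneg (by linarith) (hσ a)
  have b1 := expMajorant_one_le hH h0
  have b2 := expMajorant_two_le hH ht hσ h0 h1
  have b3 := expMajorant_three_le hH ht hσ h0 h1 h2
  have p1 := expMajorant_nonneg hA 1
  have p2 := expMajorant_nonneg hA 2
  have p3 := expMajorant_nonneg hA 3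
  have s0 := hσ 0
  have s1 := hσ 1
  have s2 := h2 2 le_rfl
  have s3 := h2 3 (by norm_num)
  have s2' := hσ 2
  have hH1 : H ≤ H ^ 4 := le_self_pow₀ hH (by norm_num)
  have hH2 : H ^ 2 ≤ H ^ 4 := pow_le_pow_right₀ hH (by norm_num)
  have hH3 : H ^ 3 ≤ H ^ 4 := pow_le_pow_right₀ hH (by norm_num)
  have ht5 : t ^ 5 ≤ t ^ 6 := pow_le_pow_right₀ ht (by norm_num)
  rw [expMajorant_succ]
  simp only [Finset.sum_range_succ, Finset.sum_range_zero]
  norm_num [Nat.choose, expMajorant_zero]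
  calc H * σ 0 * expMajorant (fun a => H * σ a) 3 + 3 * (H * σ 1) *
        expMajorant (fun a => H * σ a) 2 + 3 * (H * σ 2) *
        expMajorant (fun a => H * σ a) 1 + H * σ 3
      ≤ H * (2 * t) * (22 * H ^ 3 * t ^ 4) + 3 * (H * (2 * t ^ 3)) * (6 * H ^ 2 * t ^ 3) +
        3 * (H * (2 * t ^ (2 * 2))) * (2 * H * t) + H * (2 * t ^ (2 * 3)) := by gcongr
    _ = 44 * H ^ 4 * t ^ 5 + 36 * H ^ 3 * t ^ 6 + 12 * H ^ 2 * t ^ 5 + 2 * H * t ^ 6 := by ring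
    _ ≤ 44 * H ^ 4 * t ^ 6 + 36 * H ^ 4 * t ^ 6 + 12 * H ^ 4 * t ^ 6 + 2 * H ^ 4 * t ^ 6 := by
        gcongr
    _ = _ := by ring

theorem sum_choose_add_two_le (s : ℕ) :
    ∑ a ∈ range s, ((s + 4).choose (a + 2) : ℝ) ≤ 2 ^ (s + 4) := by
  have h := Nat.sum_range_choose (s + 4)
  have h1 : ∑ a ∈ range s, (s + 4).choose (a + 2) ≤ 2 ^ (s + 4) := by
    rw [← h, show s + 4 + 1 = (s + 3) + 1 + 1 by ring, Finset.sum_range_succ', Finset.sum_range_succ',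
      add_assoc]
    refine le_trans (Finset.sum_le_sum_of_subset ?_) (Nat.le_add_right _ _)
    exact Finset.range_subset_range.2 (by omega)
  exact_mod_cast h1

/-- Only the first and last terms have full order t·T. The others miss a factor t, which `hs'` makes
large enough to absorb their powers of x and H. -/
theorem sum_outer_terms_le {x T : ℝ} (hH : 1 ≤ H) (hx5 : 5 ≤ x) (hs' : 32 * x ^ 2 * H ^ 2 ≤ t)
    (hT0 : 0 < T) :
    150 * H ^ 4 * (t * T) + (400 * (x - 1) * H * (H ^ 4 * T) + 400 * H * (H ^ 4 * T)) +
      12 * (x - 1) ^ 2 * H ^ 3 * T + 4 * (x - 1) * H ^ 2 * T + H * (2 * (t * T)) ≤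
      200 * H ^ 4 * (t * T) := by
  have hH4 : H ≤ H ^ 4 := le_self_pow₀ hH (by norm_num)
  have ht0 : 0 < t := lt_of_lt_of_le (by positivity) hs'
  have hx1 : x ≤ x ^ 2 := le_self_pow₀ (by linarith) (by norm_num)
  have hxH : 32 * (5 * x * H) ≤ t := by
    refine le_trans ?_ hs'
    have : H ≤ H ^ 2 := le_self_pow₀ hH (by norm_num)
    calc 32 * (5 * x * H) ≤ 32 * (x * x * H ^ 2) := by gcongr
      _ = _ := by ring
  have q01 : 400 * (x - 1) * H * (H ^ 4 * T) + 400 * H * (H ^ 4 * T) ≤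
      t * (5 / 2) * (H ^ 4 * T) := by
    rw [← add_mul]
    gcongr
    linarith
  have q3 : 4 * (x - 1) * H ^ 2 * T ≤ t * T * H ^ 4 := by
    calc 4 * (x - 1) * H ^ 2 * T ≤ 32 * x ^ 2 * H ^ 2 * T := by
          gcongr ?_ * H ^ 2 * T
          linarith
      _ ≤ t * T * 1 := by rw [mul_one]; gcongr
      _ ≤ t * T * H ^ 4 := by gcongr; exact one_le_pow₀ hH
  have q2 : 12 * (x - 1) ^ 2 * H ^ 3 * T ≤ t * T * H ^ 4 := by
    calc 12 * (x - 1) ^ 2 * H ^ 3 * T ≤ 32 * x ^ 2 * H ^ 3 * T := by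
          gcongr ?_ * H ^ 3 * T
          nlinarith
      _ = 32 * x ^ 2 * H ^ 2 * (T * H) := by ring
      _ ≤ t * (T * H) := by gcongr
      _ ≤ t * (T * H ^ 4) := by gcongr
      _ = _ := by ring
  have q4 : H * (2 * (t * T)) ≤ 2 * (t * T * H ^ 4) := by
    calc H * (2 * (t * T)) ≤ H ^ 4 * (2 * (t * T)) := by gcongr
      _ = _ := by ring
  have hpos : 0 ≤ t * T * H ^ 4 := by positivity
  linarith

/-- The inductive step: middle terms lose a factor t² against the target, which pays for the
binomial sum through `hs`; the last term has full order with coefficient only 2H; the other four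
lose one factor t. -/
theorem expMajorant_add_five_le (hH : 1 ≤ H) (ht : 1 ≤ t) (hσ : ∀ a, 0 ≤ σ a)
    (h0 : σ 0 ≤ 2 * t) (h1 : σ 1 ≤ 2 * t ^ 3) (h2 : ∀ a, 2 ≤ a → σ a ≤ 2 * t ^ (2 * a)) (s : ℕ)
    (hs : H * 2 ^ (s + 5) ≤ 3 / 4 * t ^ 2) (hs' : 32 * ((s : ℝ) + 5) ^ 2 * H ^ 2 ≤ t)
    (ih : ∀ m, m < s + 2 →
      expMajorant (fun a => H * σ a) (m + 3) ≤ 200 * H ^ 4 * t ^ (2 * (m + 2))) :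
    expMajorant (fun a => H * σ a) (s + 5) ≤ 200 * H ^ 4 * t ^ (2 * (s + 4)) := by
  have hA : ∀ a, 0 ≤ H * σ a := fun a => mul_nonneg (by linarith) (hσ a)
  have b1 := expMajorant_one_le hH h0
  have b2 := expMajorant_two_le hH ht hσ h0 h1
  have p := expMajorant_nonneg hA
  set β := expMajorant (fun a => H * σ a) with hβ
  have hH0 : 0 < H := by linarith
  have ht0 : 0 < t := by linarith
  -- The top three indices meet β_2, β_1, β_0, outside the scope of `ih`; the bottom two involve σ_0
  -- and σ_1, outside that of `h2`.
  rw [hβ, expMajorant_succ, ← hβ, Finset.sum_range_succ, Finset.sum_range_succ,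
    Finset.sum_range_succ, Finset.sum_range_succ', Finset.sum_range_succ']
  have mid : ∑ a ∈ range s, ((s + 4).choose (a + 1 + 1) : ℝ) * (H * σ (a + 1 + 1)) *
      β (s + 4 - (a + 1 + 1)) ≤ 150 * H ^ 4 * t ^ (2 * (s + 4)) := by
    calc _ ≤ ∑ a ∈ range s, ((s + 4).choose (a + 2) : ℝ) * (400 * H ^ 5 * t ^ (2 * (s + 3))) := by
          refine Finset.sum_le_sum fun a ha => ?_
          have ha' := mem_range.1 ha
          obtain ⟨m, hm⟩ : ∃ m, s = a + 1 + m := ⟨s - (a + 1), by omega⟩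
          rw [show s + 4 - (a + 1 + 1) = m + 3 by omega, show a + 1 + 1 = a + 2 by ring, mul_assoc]
          have e1 := ih m (by omega)
          have e2 := h2 (a + 2) (by omega)
          have e3 := p (m + 3)
          refine mul_le_mul_of_nonneg_left ?_ (by positivity)
          calc H * σ (a + 2) * β (m + 3)
              ≤ H * (2 * t ^ (2 * (a + 2))) * (200 * H ^ 4 * t ^ (2 * (m + 2))) := by gcongr
            _ = 400 * H ^ 5 * t ^ (2 * (s + 3)) := by rw [hm]; ring
      _ ≤ 2 ^ (s + 4) * (400 * H ^ 5 * t ^ (2 * (s + 3))) := by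
          rw [← Finset.sum_mul]
          have := sum_choose_add_two_le s
          gcongr
      _ = (H * 2 ^ (s + 5)) * (200 * H ^ 4 * t ^ (2 * (s + 3))) := by ring
      _ ≤ (3 / 4 * t ^ 2) * (200 * H ^ 4 * t ^ (2 * (s + 3))) := by gcongr
      _ = _ := by ring
  have hch1 : ((s + 4).choose (0 + 1) : ℝ) = s + 4 := by simp
  have e1 : ((s + 4).choose (0 + 1) : ℝ) * (H * σ (0 + 1)) * β (s + 4 - (0 + 1)) ≤
      (s + 4) * (H * (2 * t ^ 3)) * (200 * H ^ 4 * t ^ (2 * (s + 2))) := by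
    rw [hch1]
    have := ih s (by omega)
    have := p (s + 3)
    have := hσ 1
    simp only [zero_add, show s + 4 - 1 = s + 3 by omega]
    gcongr
  have e0 : ((s + 4).choose 0 : ℝ) * (H * σ 0) * β (s + 4 - 0) ≤
      H * (2 * t) * (200 * H ^ 4 * t ^ (2 * (s + 3))) := by
    have := ih (s + 1) (by omega)
    have := p (s + 4)
    have := hσ 0
    simp only [Nat.choose_zero_right, Nat.cast_one, one_mul, Nat.sub_zero]
    gcongr
  have e4 : ((s + 4).choose (s + 4) : ℝ) * (H * σ (s + 4)) * β (s + 4 - (s + 4)) ≤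
      H * (2 * t ^ (2 * (s + 4))) := by
    have := h2 (s + 4) (by omega)
    rw [Nat.choose_self, Nat.sub_self, hβ, expMajorant_zero]
    simp only [Nat.cast_one, one_mul, mul_one]
    gcongr
  have e3 : ((s + 4).choose (s + 3) : ℝ) * (H * σ (s + 3)) * β (s + 4 - (s + 3)) ≤
      (s + 4) * (H * (2 * t ^ (2 * (s + 3)))) * (2 * H * t) := by
    have := h2 (s + 3) (by omega)
    have := p 1
    have := hσ (s + 3)
    rw [show s + 4 - (s + 3) = 1 by omega, show s + 4 = (s + 3) + 1 by ring,
      Nat.choose_succ_self_right]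
    push_cast
    rw [show (s : ℝ) + 3 + 1 = s + 4 by ring]
    gcongr
  have e2 : ((s + 4).choose (s + 2) : ℝ) * (H * σ (s + 2)) * β (s + 4 - (s + 2)) ≤
      (s + 4) ^ 2 * (H * (2 * t ^ (2 * (s + 2)))) * (6 * H ^ 2 * t ^ 3) := by
    have := h2 (s + 2) (by omega)
    have := p 2
    have := hσ (s + 2)
    have hc : ((s + 4).choose (s + 2) : ℝ) ≤ (s + 4) ^ 2 := by
      have h3 := Nat.choose_le_pow (s + 4) 2
      rw [← Nat.choose_symm (by omega : 2 ≤ s + 4), show s + 4 - 2 = s + 2 by omega] at h3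
      exact_mod_cast h3
    rw [show s + 4 - (s + 2) = 2 by omega]
    gcongr
  -- One power of t below the target t^(2(s+4)).
  set T := t ^ (2 * s + 7) with hT
  set x := (s : ℝ) + 5 with hx
  have hx5 : 5 ≤ x := by rw [hx]; linarith [Nat.cast_nonneg (α := ℝ) s]
  have hT0 : 0 < T := by positivity
  have r1 : (s + 4) * (H * (2 * t ^ 3)) * (200 * H ^ 4 * t ^ (2 * (s + 2))) =
      400 * (x - 1) * H * (H ^ 4 * T) := by rw [hT, hx]; ring
  have r0 : H * (2 * t) * (200 * H ^ 4 * t ^ (2 * (s + 3))) = 400 * H * (H ^ 4 * T) := by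
    rw [hT]; ring
  have r3 : (s + 4) * (H * (2 * t ^ (2 * (s + 3)))) * (2 * H * t) =
      4 * (x - 1) * H ^ 2 * T := by rw [hT, hx]; ring
  have r2 : ((s : ℝ) + 4) ^ 2 * (H * (2 * t ^ (2 * (s + 2)))) * (6 * H ^ 2 * t ^ 3) =
      12 * (x - 1) ^ 2 * H ^ 3 * T := by rw [hT, hx]; ring
  have rT : t ^ (2 * (s + 4)) = t * T := by rw [hT]; ring
  rw [rT] at e4 mid ⊢
  rw [r1] at e1
  rw [r0] at e0
  rw [r3] at e3
  rw [r2] at e2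
  have key := sum_outer_terms_le (x := x) hH hx5 hs' hT0
  linarith

/-- The main bound on the majorant, sharp up to constants. -/
theorem expMajorant_add_three_le (hH : 1 ≤ H) (ht : 1 ≤ t) (hσ : ∀ a, 0 ≤ σ a)
    (h0 : σ 0 ≤ 2 * t) (h1 : σ 1 ≤ 2 * t ^ 3) (h2 : ∀ a, 2 ≤ a → σ a ≤ 2 * t ^ (2 * a)) (R : ℕ)
    (hR : H * 2 ^ R ≤ 3 / 4 * t ^ 2) (hR' : 32 * (R : ℝ) ^ 2 * H ^ 2 ≤ t) (r : ℕ)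
    (hr : r + 3 ≤ R) :
    expMajorant (fun a => H * σ a) (r + 3) ≤ 200 * H ^ 4 * t ^ (2 * (r + 2)) := by
  induction r using Nat.strong_induction_on with
  | _ r ih =>
    rcases r with _ | _ | s
    · refine (expMajorant_three_le hH ht hσ h0 h1 h2).trans ?_
      have : H ^ 3 ≤ H ^ 4 := pow_le_pow_right₀ hH (by norm_num)
      norm_num
      gcongr
      norm_num
    · refine (expMajorant_four_le hH ht hσ h0 h1 h2).trans ?_
      norm_num
      gcongr
      norm_num
    · refine expMajorant_add_five_le hH ht hσ h0 h1 h2 s (le_trans ?_ hR) (le_trans ?_ hR')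
        fun m hm => ih m (by omega) (by omega)
      · gcongr
        · norm_num
      · gcongr
        exact_mod_cast hr

/-- A weaker bound on the majorant, valid for small indices as well. -/
theorem expMajorant_add_one_le (hH : 1 ≤ H) (ht : 1 ≤ t) (hσ : ∀ a, 0 ≤ σ a)
    (h0 : σ 0 ≤ 2 * t) (h1 : σ 1 ≤ 2 * t ^ 3) (h2 : ∀ a, 2 ≤ a → σ a ≤ 2 * t ^ (2 * a)) (R : ℕ)
    (hR : H * 2 ^ R ≤ 3 / 4 * t ^ 2) (hR' : 32 * (R : ℝ) ^ 2 * H ^ 2 ≤ t) (r : ℕ)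
    (hr : r + 1 ≤ R) :
    expMajorant (fun a => H * σ a) (r + 1) ≤ 200 * H ^ 4 * t ^ (2 * r + 1) := by
  have hH1 : H ≤ H ^ 4 := le_self_pow₀ hH (by norm_num)
  have hH2 : H ^ 2 ≤ H ^ 4 := pow_le_pow_right₀ hH (by norm_num)
  rcases r with _ | _ | s
  · refine (expMajorant_one_le hH h0).trans ?_
    norm_num
    gcongr
    norm_num
  · refine (expMajorant_two_le hH ht hσ h0 h1).trans ?_
    norm_num
    gcongr
    norm_num
  · refine (expMajorant_add_three_le hH ht hσ h0 h1 h2 R hR hR' s hr).trans ?_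
    gcongr 200 * H ^ 4 * t ^ ?_
    omega

end MajorantBounds

/-! ### From the mean to the majorant. -/

theorem meanBinomSum_eq (n Δ : ℕ) {q : ℕ} (hq : q ≠ 0) :
    meanBinomSum n q Δ =
      ∑ j ∈ Icc 1 Δ, meanChoose (splitCount q (j + 1)) n (Δ - j) := by
  unfold meanBinomSum meanChoose
  rw [Finset.mul_sum]
  refine Finset.sum_congr rfl fun j _ => ?_
  rw [one_div, inv_mul_eq_div]
  congr 1
  refine Finset.sum_congr rfl fun π _ => ?_
  rw [← sum_count_parts_pow π hq (j + 1)]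
  unfold cycleCount
  norm_cast

/-- The slope 3/4 gives equality at j = 1. It matches the 3/4 in the hypothesis `hR` of the majorant
bounds, which thus reduces to (j+1) 2^R ≤ q. -/
theorem sum_Icc_one_div_le {j : ℕ} (hj : 1 ≤ j) :
    ∑ i ∈ Icc 1 (j + 1), (1 / i : ℝ) ≤ 3 / 4 * (j + 1) := by
  induction j, hj using Nat.le_induction with
  | base => norm_num [Finset.sum_Icc_succ_top]
  | succ j hj ih =>
    rw [Finset.sum_Icc_succ_top (by omega)]
    have hj' : (1 : ℝ) ≤ j := by exact_mod_cast hj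
    have : (1 / ((j + 1 + 1 : ℕ) : ℝ)) ≤ 3 / 4 := by
      rw [div_le_iff₀ (by positivity)]
      push_cast
      linarith
    push_cast at this ⊢
    linarith

theorem meanChoose_splitCount_le {q j : ℕ} (hq : q ≠ 0) (hj : 1 ≤ j) (n r : ℕ) :
    meanChoose (splitCount q (j + 1)) n r ≤
      expMajorant (fun a => 3 / 4 * ((j : ℝ) + 1) * ArithmeticFunction.sigma a q) r / r ! :=
  meanChoose_le_expMajorant (fun a => by positivity)
    (fun n a => sum_splitCount_le hq (sum_Icc_one_div_le hj) n a) r n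

theorem factorial_le_sub_mul_pow {j Δ : ℕ} (h : j ≤ Δ) : Δ ! ≤ (Δ - j)! * Δ ^ j := by
  rw [← Nat.factorial_mul_descFactorial h]
  exact Nat.mul_le_mul_left _ (Nat.descFactorial_le_pow Δ j)

/-! ### The case Δ ≥ 4. -/

section LargeDelta

variable {q Δ : ℕ}

/-- The term j = 1, where H = 3/2: then 72 = 32 (3/2)² and 200 (3/2)^4 = 1012.5 ≤ 1100. -/
theorem expMajorant_sigma_main_le (hΔ : 4 ≤ Δ) (hpow : (2 : ℝ) ^ Δ ≤ q)
    (hlog : 72 * (Δ : ℝ) ^ 6 ≤ √q) :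
    expMajorant (fun a => 3 / 4 * (((1 : ℕ) : ℝ) + 1) * ArithmeticFunction.sigma a q) (Δ - 1) ≤
      1100 * (q : ℝ) ^ (Δ - 2) := by
  obtain ⟨e, rfl⟩ : ∃ e, Δ = e + 4 := ⟨Δ - 4, by omega⟩
  have hsq : (√q : ℝ) ^ 2 = q := Real.sq_sqrt (by positivity)
  have hD : (4 : ℝ) ≤ ((e + 4 : ℕ) : ℝ) := by exact_mod_cast hΔ
  set D : ℝ := ((e + 4 : ℕ) : ℝ)
  have ht : 1 ≤ √(q : ℝ) := by
    have : 1 ≤ D ^ 6 := one_le_pow₀ (by linarith)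
    linarith
  have h := expMajorant_add_three_le (σ := fun a => (ArithmeticFunction.sigma a q : ℝ))
    (H := 3 / 4 * (((1 : ℕ) : ℝ) + 1)) (t := √q) (by norm_num) ht (fun a => by positivity)
    (sigma_zero_le_two_mul_sqrt q)
    ((sigma_one_le q).trans_eq (by rw [mul_assoc, pow_succ, hsq]))
    (fun a ha => (sigma_le_two_mul_pow q ha).trans_eq (by rw [pow_mul, hsq])) (e + 3)
    (by
      rw [hsq]
      rw [pow_succ] at hpow
      norm_num
      linarith)
    (by
      refine le_trans ?_ hlog
      have h1 : ((e + 3 : ℕ) : ℝ) ≤ D := Nat.cast_le.2 (Nat.le_succ (e + 3))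
      have h2 : D ^ 2 ≤ D ^ 6 := pow_le_pow_right₀ (by linarith) (by norm_num)
      calc 32 * ((e + 3 : ℕ) : ℝ) ^ 2 * (3 / 4 * (((1 : ℕ) : ℝ) + 1)) ^ 2
          ≤ 32 * D ^ 2 * (3 / 4 * (((1 : ℕ) : ℝ) + 1)) ^ 2 := by gcongr
        _ = 72 * D ^ 2 := by norm_num; ring
        _ ≤ 72 * D ^ 6 := by gcongr) e le_rfl
  rw [pow_mul, hsq] at h
  refine h.trans ?_
  rw [show e + 4 - 2 = e + 2 by omega]
  gcongr
  norm_num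

/-- The factor Δ^j compensates for replacing 1/(Δ-j)! by 1/Δ!. Of it, Δ² joins the Δ^4 coming from
H^4 and is absorbed by one √q; the remaining Δ^(j-2) is at most q^(j-2). -/
theorem expMajorant_sigma_lower_le (hΔ : 4 ≤ Δ) (hpow : (2 : ℝ) ^ Δ ≤ q)
    (hlog : 72 * (Δ : ℝ) ^ 6 ≤ √q) {j : ℕ} (hj : 2 ≤ j) (hjΔ : j ≤ Δ) :
    expMajorant (fun a => 3 / 4 * ((j : ℝ) + 1) * ArithmeticFunction.sigma a q) (Δ - j) *
      (Δ : ℝ) ^ j ≤ 1100 * (q : ℝ) ^ (Δ - 2) := by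
  have hsq : (√q : ℝ) ^ 2 = q := Real.sq_sqrt (by positivity)
  have hD : (4 : ℝ) ≤ Δ := by exact_mod_cast hΔ
  have hD6 : (Δ : ℝ) ^ 6 ≤ √q := by
    have : 0 ≤ (Δ : ℝ) ^ 6 := by positivity
    linarith
  have ht : 1 ≤ √(q : ℝ) := le_trans (one_le_pow₀ (by linarith)) hD6
  have hDt : (Δ : ℝ) ≤ √q := le_trans (le_self_pow₀ (by linarith) (by norm_num)) hD6
  have hDq : (Δ : ℝ) ≤ q := by
    rw [← hsq]
    exact hDt.trans (le_self_pow₀ ht (by norm_num))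
  have hq1 : (1 : ℝ) ≤ q := by linarith
  have hH : 3 / 4 * ((j : ℝ) + 1) ≤ 3 / 2 * Δ := by
    have : (j : ℝ) ≤ Δ := by exact_mod_cast hjΔ
    linarith
  have hj' : (2 : ℝ) ≤ j := by exact_mod_cast hj
  -- For j = Δ the majorant is 1, and Δ^Δ ≤ q^(Δ-2) follows from Δ^4 ≤ q² and Δ ≤ q.
  rcases hjΔ.eq_or_lt with rfl | hlt
  · obtain ⟨e, rfl⟩ : ∃ e, j = e + 4 := ⟨j - 4, by omega⟩
    rw [Nat.sub_self, expMajorant_zero, one_mul, show e + 4 - 2 = e + 2 by omega]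
    set D : ℝ := ((e + 4 : ℕ) : ℝ)
    have h4 : D ^ 4 ≤ (q : ℝ) ^ 2 := by
      calc D ^ 4 ≤ D ^ 6 := pow_le_pow_right₀ (by linarith) (by norm_num)
        _ ≤ √q := hD6
        _ ≤ √q ^ 4 := le_self_pow₀ ht (by norm_num)
        _ = (q : ℝ) ^ 2 := by rw [← hsq, ← pow_mul, hsq]
    calc D ^ (e + 4) = D ^ e * D ^ 4 := pow_add _ _ _
      _ ≤ (q : ℝ) ^ e * (q : ℝ) ^ 2 := by gcongr
      _ = 1 * (q : ℝ) ^ (e + 2) := by rw [pow_add, one_mul]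
      _ ≤ _ := by gcongr; norm_num
  · obtain ⟨i, rfl⟩ : ∃ i, j = i + 2 := ⟨j - 2, by omega⟩
    obtain ⟨r, hr⟩ : ∃ r, Δ = i + 3 + r := ⟨Δ - (i + 3), by omega⟩
    have h := expMajorant_add_one_le (σ := fun a => (ArithmeticFunction.sigma a q : ℝ))
      (H := 3 / 4 * (((i + 2 : ℕ) : ℝ) + 1)) (t := √q) (by linarith) ht
      (fun a => by positivity)
      (sigma_zero_le_two_mul_sqrt q)
      ((sigma_one_le q).trans_eq (by rw [mul_assoc, pow_succ, hsq]))
      (fun a ha => (sigma_le_two_mul_pow q ha).trans_eq (by rw [pow_mul, hsq])) (r + 1)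
      (by
        rw [hsq, mul_assoc]
        gcongr
        refine le_trans ?_ hpow
        -- j + 1 ≤ 2^j turns (j+1) 2^(Δ-j) into at most 2^Δ.
        have h1 : i + 2 + 1 ≤ 2 ^ (i + 2) := Nat.lt_two_pow_self
        have h2 : (((i + 2 : ℕ) : ℝ) + 1) ≤ 2 ^ (i + 2) := by exact_mod_cast h1
        calc (((i + 2 : ℕ) : ℝ) + 1) * 2 ^ (r + 1) ≤ 2 ^ (i + 2) * 2 ^ (r + 1) := by gcongr
          _ = 2 ^ Δ := by rw [← pow_add, hr]; congr 1; omega)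
      (by
        refine le_trans ?_ hlog
        have h1 : ((r + 1 : ℕ) : ℝ) ≤ Δ := by exact_mod_cast (by omega : r + 1 ≤ Δ)
        have h2 : (Δ : ℝ) ^ 4 ≤ (Δ : ℝ) ^ 6 := pow_le_pow_right₀ (by linarith) (by norm_num)
        calc 32 * ((r + 1 : ℕ) : ℝ) ^ 2 * (3 / 4 * (((i + 2 : ℕ) : ℝ) + 1)) ^ 2
            ≤ 32 * (Δ : ℝ) ^ 2 * (3 / 2 * Δ) ^ 2 := by gcongr
          _ = 72 * (Δ : ℝ) ^ 4 := by ring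
          _ ≤ _ := by gcongr) r le_rfl
    rw [show Δ - (i + 2) = r + 1 by omega, show Δ - 2 = r + 1 + i by omega]
    calc _ ≤ 200 * (3 / 4 * (((i + 2 : ℕ) : ℝ) + 1)) ^ 4 * √q ^ (2 * r + 1) *
          (Δ : ℝ) ^ (i + 2) := by gcongr
      _ ≤ 200 * (3 / 2 * Δ) ^ 4 * √q ^ (2 * r + 1) * (Δ : ℝ) ^ (i + 2) := by gcongr
      _ = 2025 / 2 * ((Δ : ℝ) ^ 6 * √q ^ (2 * r + 1) * (Δ : ℝ) ^ i) := by ring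
      _ ≤ 2025 / 2 * (√q * √q ^ (2 * r + 1) * (q : ℝ) ^ i) := by gcongr
      _ = 2025 / 2 * (q : ℝ) ^ (r + 1 + i) := by
          rw [← _root_.pow_succ', show 2 * r + 1 + 1 = 2 * (r + 1) by ring, pow_mul, hsq, ← pow_add]
      _ ≤ _ := by gcongr; norm_num

theorem meanBinomSum_le_of_four_le (hΔ : 4 ≤ Δ) (hq : q ≠ 0) (hpow : (2 : ℝ) ^ Δ ≤ q)
    (hlog : 72 * (Δ : ℝ) ^ 6 ≤ √q) (n : ℕ) :
    meanBinomSum n q Δ ≤ 2200 * (1 / ((Δ - 1)! : ℝ) * (q : ℝ) ^ (Δ - 2)) := by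
  rw [meanBinomSum_eq n Δ hq, ← Finset.add_sum_Ioc_eq_sum_Icc (by omega : 1 ≤ Δ)]
  set M : ℝ := 1 / ((Δ - 1)! : ℝ) * (q : ℝ) ^ (Δ - 2) with hM
  have hM0 : 0 ≤ M := by positivity
  have hD0 : (0 : ℝ) < Δ := by exact_mod_cast (by omega : 0 < Δ)
  have h1 : meanChoose (splitCount q (1 + 1)) n (Δ - 1) ≤ 1100 * M := by
    refine (meanChoose_splitCount_le hq le_rfl n (Δ - 1)).trans ?_
    rw [div_le_iff₀ (by positivity)]
    refine (expMajorant_sigma_main_le hΔ hpow hlog).trans_eq ?_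
    rw [hM]
    field_simp
  have h2 : ∀ j ∈ Ioc 1 Δ, meanChoose (splitCount q (j + 1)) n (Δ - j) ≤ 1100 * M / Δ := by
    intro j hj
    obtain ⟨hj1, hjΔ⟩ := mem_Ioc.1 hj
    refine (meanChoose_splitCount_le hq hj1.le n (Δ - j)).trans ?_
    have h3 := expMajorant_sigma_lower_le hΔ hpow hlog hj1 hjΔ
    have h4 : (Δ ! : ℝ) ≤ (Δ - j)! * (Δ : ℝ) ^ j := by
      exact_mod_cast factorial_le_sub_mul_pow hjΔ
    have h5 : (Δ ! : ℝ) = Δ * (Δ - 1)! := by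
      exact_mod_cast (Nat.mul_factorial_pred (by omega : Δ ≠ 0)).symm
    have h6 : 1100 * M / Δ = 1100 * (q : ℝ) ^ (Δ - 2) / Δ ! := by
      rw [hM, h5]
      field_simp
    have h7 := expMajorant_nonneg
      (A := fun a => 3 / 4 * ((j : ℝ) + 1) * ArithmeticFunction.sigma a q)
      (fun a => by positivity) (Δ - j)
    rw [h6, div_le_div_iff₀ (by positivity) (by positivity)]
    calc _ ≤ expMajorant (fun a => 3 / 4 * ((j : ℝ) + 1) * ArithmeticFunction.sigma a q)
            (Δ - j) * ((Δ - j)! * (Δ : ℝ) ^ j) := by gcongr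
      _ = (expMajorant (fun a => 3 / 4 * ((j : ℝ) + 1) * ArithmeticFunction.sigma a q)
            (Δ - j) * (Δ : ℝ) ^ j) * (Δ - j)! := by ring
      _ ≤ _ := by gcongr
  have h3 : ∑ j ∈ Ioc 1 Δ, meanChoose (splitCount q (j + 1)) n (Δ - j) ≤ 1100 * M := by
    refine (Finset.sum_le_card_nsmul _ _ _ h2).trans ?_
    rw [Nat.card_Ioc, nsmul_eq_mul]
    calc ((Δ - 1 : ℕ) : ℝ) * (1100 * M / Δ) ≤ Δ * (1100 * M / Δ) := by
          gcongr
          omega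
      _ = _ := by field_simp
  linarith

end LargeDelta

/-! ### The cases Δ ≤ 3 and the conclusion. -/

theorem meanBinomSum_one {q : ℕ} (hq : q ≠ 0) (n : ℕ) : meanBinomSum n q 1 = 1 := by
  rw [meanBinomSum_eq n 1 hq]
  simp [meanChoose_zero]

theorem expMajorant_one_eq (A : ℕ → ℝ) : expMajorant A 1 = A 0 := by
  simp [expMajorant_succ, expMajorant_zero]

theorem one_le_sigma {q : ℕ} (hq : q ≠ 0) (k : ℕ) :
    (1 : ℝ) ≤ ArithmeticFunction.sigma k q := by
  exact_mod_cast ArithmeticFunction.sigma_pos k q hq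

theorem meanBinomSum_two_le {q : ℕ} (hq : q ≠ 0) (n : ℕ) :
    meanBinomSum n q 2 ≤ 3 * ArithmeticFunction.sigma 0 q := by
  rw [meanBinomSum_eq n 2 hq, Finset.sum_Icc_succ_top (by norm_num), Icc_self, sum_singleton]
  have h1 := meanChoose_splitCount_le hq le_rfl n 1
  rw [expMajorant_one_eq] at h1
  have h0 := one_le_sigma hq 0
  norm_num [meanChoose_zero] at h1 ⊢
  linarith

/-- The square in β_2 = H²σ_0² + Hσ_1 is harmless because σ_0² ≤ 4q ≤ 4σ_1. -/
theorem meanBinomSum_three_le {q : ℕ} (hq : q ≠ 0) (n : ℕ) :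
    meanBinomSum n q 3 ≤ 10 * ArithmeticFunction.sigma 1 q := by
  rw [meanBinomSum_eq n 3 hq, Finset.sum_Icc_succ_top (by norm_num),
    Finset.sum_Icc_succ_top (by norm_num), Icc_self, sum_singleton]
  have h1 := meanChoose_splitCount_le hq le_rfl n 2
  have h2 := meanChoose_splitCount_le hq (by norm_num : 1 ≤ 2) n 1
  rw [expMajorant_one_eq] at h2
  rw [expMajorant_two_eq] at h1
  have h0 := one_le_sigma hq 1
  have h3 : (ArithmeticFunction.sigma 0 q : ℝ) ≤ ArithmeticFunction.sigma 1 q := by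
    exact_mod_cast ArithmeticFunction.sigma_mono 0 1 q zero_le_one
  have h4 : (ArithmeticFunction.sigma 0 q : ℝ) ^ 2 ≤ 4 * ArithmeticFunction.sigma 1 q := by
    have h5 : q ≤ ArithmeticFunction.sigma 1 q := by
      rw [ArithmeticFunction.sigma_one_apply]
      exact Finset.single_le_sum (f := fun d => d) (fun _ _ => Nat.zero_le _)
        (Nat.mem_divisors_self q hq)
    calc (ArithmeticFunction.sigma 0 q : ℝ) ^ 2 ≤ (2 * √q) ^ 2 := by
          gcongr
          exact sigma_zero_le_two_mul_sqrt q
      _ = 4 * (q : ℝ) := by rw [mul_pow, Real.sq_sqrt (by positivity)]; norm_num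
      _ ≤ _ := by gcongr
  norm_num [meanChoose_zero, Nat.factorial] at h1 h2 ⊢
  linarith

/-- After squaring, this is log^12 q = o(q). -/
theorem eventually_log_pow_le_sqrt :
    ∀ᶠ q : ℕ in Filter.atTop, 72 * (Real.log q / Real.log 2) ^ 6 ≤ √(q : ℝ) := by
  have hlog2 : 0 < Real.log 2 := Real.log_pos (by norm_num)
  have h := ((Real.isLittleO_pow_log_id_atTop (n := 12)).comp_tendsto
    (tendsto_natCast_atTop_atTop (R := ℝ))).bound
    (c := ((72 / Real.log 2 ^ 6) ^ 2)⁻¹) (by positivity)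
  filter_upwards [h] with q hq
  simp only [Function.comp_apply, id, Real.norm_eq_abs, abs_pow, Nat.abs_cast] at hq
  rw [← div_eq_inv_mul, le_div_iff₀ (by positivity)] at hq
  apply Real.le_sqrt_of_sq_le
  refine le_trans (le_of_eq ?_) hq
  rw [← abs_pow, abs_of_nonneg (by positivity)]
  field_simp

end

theorem mainTheorem6 :
    ∃ (C : ℝ) (q₀ : ℕ), ∀ q : ℕ, q₀ ≤ q →
      ∀ Δ : ℕ, 1 ≤ Δ → (Δ : ℝ) ≤ Real.log q / Real.log 2 →
        ∀ n : ℕ, 1 ≤ n →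
          (Δ = 1 → meanBinomSum n q Δ ≤ C) ∧
          (Δ = 2 → meanBinomSum n q Δ ≤ C * (ArithmeticFunction.sigma 0 q : ℝ)) ∧
          (Δ = 3 → meanBinomSum n q Δ ≤ C * (ArithmeticFunction.sigma 1 q : ℝ)) ∧
          (4 ≤ Δ → meanBinomSum n q Δ ≤
            C * (1 / ((Δ - 1).factorial : ℝ) * (q : ℝ) ^ (Δ - 2))) := by
  obtain ⟨q₁, hq₁⟩ := Filter.eventually_atTop.1 eventually_log_pow_le_sqrt
  refine ⟨2200, max q₁ 1, fun q hq Δ hΔ1 hΔ n _ => ?_⟩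
  have hq0 : q ≠ 0 := by have := le_of_max_le_right hq; omega
  refine ⟨?_, ?_, ?_, ?_⟩
  · rintro rfl
    rw [meanBinomSum_one hq0]
    norm_num
  · rintro rfl
    refine (meanBinomSum_two_le hq0 n).trans ?_
    gcongr
    norm_num
  · rintro rfl
    refine (meanBinomSum_three_le hq0 n).trans ?_
    gcongr
    norm_num
  · intro h4
    refine meanBinomSum_le_of_four_le h4 hq0 ?_ ?_ n
    · have hlog2 : 0 < Real.log 2 := Real.log_pos (by norm_num)
      have hqpos : (0 : ℝ) < q := by positivity
      rw [le_div_iff₀ hlog2, ← Real.log_pow] at hΔ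
      exact (Real.log_le_log_iff (by positivity) hqpos).1 hΔ
    · refine le_trans ?_ (hq₁ q (le_of_max_le_left hq))
      gcongr
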